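/- For a unit vector $\mathbf n\in S^2\subset\mathbb R^3$ consider the qubit effect $E(\mathbf n)=\tfrac13(\mathbf 1+\mathbf n\cdot\vec\sigma)$, where $\vec\sigma=(\sigma_x,\sigma_y,\sigma_z)$ are the Pauli matrices. A trine is a triple of unit vectors with mutual angles $120^\circ$ (three unit vectors equally spaced in a plane; all trines are rotations of one another, and their vectors sum to zero), and a trine POVM is a triple $E(\mathbf n_1),E(\mathbf n_2),E(\mathbf n_3)$ with $\mathbf n_1,\mathbf n_2,\mathbf n_3$ a trine. Let $f:\{E(\mathbf n):\mathbf n\in S^2\}\to[0,1]$ be a trine frame function, i.e. $\sum_j f(E_j)=1$ for every trine POVM $(E_1,E_2,E_3)$, and suppose that $F(\mathbf n)=f(E(\mathbf n))$ is continuous on $S^2$. Let $Y_{lm}$ ($l\ge 0$, $-l\le m\le l$) be the usual spherical harmonics and $c_{lm}=\int_{S^2}F\,\overline{Y_{lm}}\,d\Omega$ the coefficients of $F$. 1. $f$ is given by the quantum rule: there is a density operator $W$ (positive semidefinite, $\operatorname{tr}W=1$) with $f(E)=\operatorname{tr}(WE)$ for all trine effects $E$, and the real vector $\vec P=\operatorname{tr}(W\vec\sigma)$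 satisfies $\|\vec P\|\le 1$ and $$F(\mathbf n)=\tfrac13\,(1+\mathbf n\cdot\vec P)\qquad\text{for all }\mathbf n\in S^2 .$$ All harmonics $l\ge2$ are excluded: $c_{lm}=0$ for all $l\ge 2$ and $|m|\le l$. 2. Conversely, for every $\vec P\in\mathbb R^3$ with $\|\vec P\|\le1$, the function $f(E(\mathbf n))=\tfrac13(1+\mathbf n\cdot\vec P)$ is a trine frame function with $F$ continuous. 3. Let $\mathbf n_1=\mathbf e_x$, $\mathbf n_{2,3}=-\tfrac12\mathbf e_x\pm\tfrac{\sqrt3}{2}\mathbf e_z$, which is a trine. For every $l\ge0$ there is a constant $\kappa_l\ne0$ such that $Y_{ll}(\mathbf n)=\kappa_l(n_x+in_y)^l$ for all $\mathbf n\in S^2$ and $$\sum_{j=1}^3Y_{ll}(\mathbf n_j)=\kappa_l\left(1+\frac{(-1)^l}{2^{\,l-1}}\right),$$ and this sum is nonzero if and only if $l\neq1$. -/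

import Mathlib

open scoped ComplexOrder

noncomputable section

/-- Three-dimensional Euclidean space; coordinates `0, 1, 2` are `x, y, z`. -/
abbrev Space3 : Type := EuclideanSpace ℝ (Fin 3)

/-- The unit sphere of directions (the Bloch sphere). -/
abbrev UnitSphere : Type := Metric.sphere (0 : Space3) 1

/-- Operators on a qubit. -/
abbrev QubitOp : Type := Matrix (Fin 2) (Fin 2) ℂ

/-- The Pauli matrices `σ_x, σ_y, σ_z`. -/
def pauli : Fin 3 → QubitOp :=
  ![!![0, 1; 1, 0], !![0, -Complex.I; Complex.I, 0], !![1, 0; 0, -1]]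

/-- The operator `(1 + n · σ) / 3`. -/
def effectOp (n : UnitSphere) : QubitOp :=
  (1 / 3 : ℂ) • (1 + ∑ k, (((n : Space3) k : ℝ) : ℂ) • pauli k)

/-- The effects that occur in trine measurements: all `(1 + n · σ) / 3` with `n` a unit vector. -/
def trineEffects : Set QubitOp := Set.range effectOp

/-- The trine effect with direction `n`. -/
def trineEffect (n : UnitSphere) : trineEffects := ⟨effectOp n, Set.mem_range_self n⟩

/-- Three unit vectors at mutual angles of 120 degrees. Such vectors sum to zero, hence lie in a
plane, and all such triples are rotations of one another. -/
def IsTrine (n : Fin 3 → UnitSphere) : Prop :=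
  ∀ i j, i ≠ j →
    InnerProductGeometry.angle (n i : Space3) (n j : Space3) = 2 * Real.pi / 3

/-- The trine POVMs: the three effects `(1 + n_j · σ) / 3` of a trine `n_1, n_2, n_3`. -/
def IsTrinePOVM (X : Fin 3 → trineEffects) : Prop :=
  ∃ n : Fin 3 → UnitSphere, IsTrine n ∧ ∀ j, X j = trineEffect (n j)

/-- Frame functions on the trine effects: values in `[0, 1]`, normalized on every trine POVM. -/
structure IsTrineFrameFunction (f : trineEffects → ℝ) : Prop where
  mem_Icc : ∀ E, f E ∈ Set.Icc (0 : ℝ) 1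
  sum_eq_one : ∀ X : Fin 3 → trineEffects, IsTrinePOVM X → ∑ j, f (X j) = 1

/-- The function `F(n) = f((1 + n · σ) / 3)` on the unit sphere. -/
def onSphere (f : trineEffects → ℝ) (n : UnitSphere) : ℝ := f (trineEffect n)

/-- The unit vector with polar angle `θ` and azimuth `φ`. -/
def sphericalPoint (θ φ : ℝ) : UnitSphere :=
  ⟨!₂[Real.sin θ * Real.cos φ, Real.sin θ * Real.sin φ, Real.cos θ], by
    rw [mem_sphere_zero_iff_norm, EuclideanSpace.norm_eq, Real.sqrt_eq_one]
    simp only [Fin.sum_univ_three, Real.norm_eq_abs, sq_abs]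
    simp
    nlinarith [Real.sin_sq_add_cos_sq θ, Real.sin_sq_add_cos_sq φ]⟩

/-- For `m ≥ 0`, the polynomial `(-1)^m / (2^l l!) * (d/dx)^(l+m) (x^2 - 1)^l`, which is the
associated Legendre function `P_l^m(x)` (with the Condon-Shortley phase) divided by
`(1 - x^2)^(m/2)`. -/
def legendreFactor (l m : ℕ) : Polynomial ℝ :=
  Polynomial.C ((-1) ^ m / (2 ^ l * (l.factorial : ℝ))) *
    Polynomial.derivative^[l + m] ((Polynomial.X ^ 2 - 1) ^ l)

/-- The spherical harmonic `Y_{lm}` for `0 ≤ m ≤ l`. On the unit sphere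
`(1 - n_z^2)^(m/2) e^{imφ} = (n_x + i n_y)^m`, so this is
`sqrt((2l+1)/(4π) * (l-m)!/(l+m)!) * P_l^m(cos θ) * e^{imφ}`. -/
def sphericalHarmonicNat (l m : ℕ) (n : UnitSphere) : ℂ :=
  ((Real.sqrt ((2 * l + 1) / (4 * Real.pi) * (((l - m).factorial : ℝ) / ((l + m).factorial : ℝ))) *
      (legendreFactor l m).eval ((n : Space3) 2) : ℝ) : ℂ) *
    ((((n : Space3) 0 : ℝ) : ℂ) + Complex.I * (((n : Space3) 1 : ℝ) : ℂ)) ^ m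

/-- The spherical harmonic `Y_{lm}` for `-l ≤ m ≤ l`, with `Y_{l,-m} = (-1)^m` times the complex
conjugate of `Y_{lm}`. -/
def sphericalHarmonic (l : ℕ) (m : ℤ) (n : UnitSphere) : ℂ :=
  if 0 ≤ m then sphericalHarmonicNat l m.natAbs n
  else (-1) ^ m.natAbs * (starRingEnd ℂ) (sphericalHarmonicNat l m.natAbs n)

/-- The coefficient `c_{lm}` of `Y_{lm}` in the spherical-harmonic expansion of `F`, that is, the
integral of `F` times the conjugate of `Y_{lm}` against the surface measure `sin θ dθ dφ`. -/
def harmonicCoeff (F : UnitSphere → ℝ) (l : ℕ) (m : ℤ) : ℂ :=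
  ∫ φ in (0 : ℝ)..(2 * Real.pi), ∫ θ in (0 : ℝ)..Real.pi,
    (F (sphericalPoint θ φ) : ℂ) * (starRingEnd ℂ) (sphericalHarmonic l m (sphericalPoint θ φ)) *
      (Real.sin θ : ℂ)

/-- The particular trine `e_x`, `-e_x/2 + (√3/2) e_z`, `-e_x/2 - (√3/2) e_z`. -/
def xzTrine : Fin 3 → UnitSphere :=
  ![⟨!₂[1, 0, 0], by simp [EuclideanSpace.norm_eq, Fin.sum_univ_three]⟩,
    ⟨!₂[-1 / 2, 0, Real.sqrt 3 / 2], by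
      rw [mem_sphere_zero_iff_norm, EuclideanSpace.norm_eq, Real.sqrt_eq_one]
      simp only [Fin.sum_univ_three, Real.norm_eq_abs, sq_abs]
      simp [div_pow]
      norm_num⟩,
    ⟨!₂[-1 / 2, 0, -(Real.sqrt 3 / 2)], by
      rw [mem_sphere_zero_iff_norm, EuclideanSpace.norm_eq, Real.sqrt_eq_one]
      simp only [Fin.sum_univ_three, Real.norm_eq_abs, sq_abs]
      simp [div_pow]
      norm_num⟩]

end

open scoped ComplexOrder

noncomputable section

/-! Subtract 1/3 from `F` and extend homogeneously of degree one to `g` on space, so that `g` sums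
to zero over trines. Average `g` over circles of latitude: the result depends only on the height
`t`, and as rotated trines are trines it satisfies `h a + h b + h (-a - b) = 0` at the heights of
any trine. Boundedness forces `h t = t * h 1`, where `h 1` is 2π times the value at the pole
(`integral_rotZ_of_norm_eq_one`). Integrated against a radial weight, this says that the moment of
`g` in direction `p` is a positive constant times `g p` (`integral_mul_inner`). The moment is linear
in `p`, hence so is `g` on unit vectors. No harmonic analysis enters here. The density operator is
the Bloch operator of the resulting vector. Harmonics with `l ≥ 2` are then excluded by direct
integration of an affine function: the azimuthal integral leaves only `|m| ≤ 1`, and Rodrigues'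
formula with integration by parts handles those. -/

/-! ### The functional equation of trine heights -/

/-- A bounded function that sums to zero over small triples with sum zero is linear on
`[-1, 1]`. -/
theorem eq_mul_of_locally_additive {h : ℝ → ℝ} {B : ℝ} (hB : ∀ t, |h t| ≤ B)
    (hadd : ∀ a b, a ^ 2 + a * b + b ^ 2 ≤ 3 / 4 → h a + h b + h (-a - b) = 0)
    {t : ℝ} (ht : |t| ≤ 1) : h t = t * h 1 := by
  have h0 : h 0 = 0 := by
    have := hadd 0 0 (by norm_num)
    norm_num at this
    linarith
  have hneg : ∀ a, |a| ≤ 1 / 2 → h (-a) = -h a := fun a ha => by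
    have h1 := abs_le.mp ha
    have := hadd a 0 (by nlinarith)
    simp only [sub_zero] at this
    linarith
  -- The triple `(-a, -a, 2a)` is admissible exactly for `|a| ≤ 1/2`, so doubling just reaches
  -- height 1.
  have hdouble : ∀ a, |a| ≤ 1 / 2 → h (2 * a) = 2 * h a := fun a ha => by
    have h1 := abs_le.mp ha
    have := hadd (-a) (-a) (by nlinarith)
    rw [show - -a - -a = 2 * a by ring, hneg a ha] at this
    linarith
  have hhalf : ∀ a, 0 ≤ a → a ≤ 1 / 2 → h a + h (1 / 2 - a) = h (1 / 2) := fun a h1 h2 => by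
    have := hadd a (1 / 2 - a) (by nlinarith)
    rw [show -a - (1 / 2 - a) = -(1 / 2) by ring, hneg (1 / 2) (by norm_num [abs_of_pos])] at this
    linarith
  -- The deviation from linearity on `[0, 1/2]` is odd under `a ↦ 1/2 - a`, and doubling `[0, 1/4]`
  -- onto `[0, 1/2]` doubles it. Any bound on it can therefore be halved, so boundedness replaces
  -- continuity.
  have hmain : ∀ n : ℕ, ∀ a, 0 ≤ a → a ≤ 1 / 2 →
      |h a - 2 * a * h (1 / 2)| ≤ (2 * B) / 2 ^ n := by
    intro n
    induction n with
    | zero =>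
      intro a h1 h2
      have e1 := abs_le.mp (hB a)
      have e2 := abs_le.mp (hB (1 / 2))
      rw [pow_zero, div_one, abs_le]
      constructor <;> nlinarith
    | succ n ih =>
      have hsmall : ∀ a, 0 ≤ a → a ≤ 1 / 4 →
          |h a - 2 * a * h (1 / 2)| ≤ (2 * B) / 2 ^ (n + 1) := by
        intro a h1 h2
        have e := ih (2 * a) (by linarith) (by linarith)
        rw [hdouble a (by rw [abs_le]; constructor <;> linarith),
          show 2 * h a - 2 * (2 * a) * h (1 / 2) = 2 * (h a - 2 * a * h (1 / 2)) by ring,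
          abs_mul, abs_two] at e
        rw [pow_succ, ← div_div]
        linarith
      intro a h1 h2
      rcases le_total a (1 / 4) with h3 | h3
      · exact hsmall a h1 h3
      · have e := hsmall (1 / 2 - a) (by linarith) (by linarith)
        have e2 := hhalf a h1 h2
        rw [show h (1 / 2 - a) - 2 * (1 / 2 - a) * h (1 / 2) = -(h a - 2 * a * h (1 / 2)) by
          linarith, abs_neg] at e
        exact e
  have hlin : ∀ a, 0 ≤ a → a ≤ 1 / 2 → h a = 2 * a * h (1 / 2) := by
    intro a h1 h2
    have hlim : Filter.Tendsto (fun n : ℕ => (2 * B) / 2 ^ n) Filter.atTop (nhds 0) :=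
      tendsto_const_nhds.div_atTop (tendsto_pow_atTop_atTop_of_one_lt one_lt_two)
    have := ge_of_tendsto' hlim (fun n => hmain n a h1 h2)
    exact sub_eq_zero.mp (abs_nonpos_iff.mp this)
  have hone : h 1 = 2 * h (1 / 2) := by
    have := hdouble (1 / 2) (by norm_num [abs_of_pos])
    norm_num at this
    simpa using this
  have hlin' : ∀ a, |a| ≤ 1 / 2 → h a = a * h 1 := by
    intro a ha
    have h1 := abs_le.mp ha
    rcases le_total 0 a with h2 | h2
    · rw [hlin a h2 h1.2, hone]; ring
    · have e := hlin (-a) (by linarith) (by linarith)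
      rw [hneg a ha] at e
      rw [hone]; linarith
  have e := hdouble (t / 2) (by rw [abs_div, abs_two]; linarith)
  rw [hlin' (t / 2) (by rw [abs_div, abs_two]; linarith), mul_div_cancel₀ _ two_ne_zero] at e
  rw [e]; ring

/-! ### Rotations about the polar axis and trines with given heights -/

/-- The rotation by the angle `ψ` about the `z`-axis. -/
def rotZ (ψ : ℝ) : Space3 ≃ₗᵢ[ℝ] Space3 :=
  LinearIsometry.toLinearIsometryEquiv
    { toFun := fun x => !₂[Real.cos ψ * x 0 - Real.sin ψ * x 1,
        Real.sin ψ * x 0 + Real.cos ψ * x 1, x 2]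
      map_add' := fun x y => by
        ext i; fin_cases i <;> simp <;> ring
      map_smul' := fun c x => by
        ext i; fin_cases i <;> simp <;> ring
      norm_map' := fun x => by
        rw [EuclideanSpace.norm_eq, EuclideanSpace.norm_eq]
        congr 1
        simp [Fin.sum_univ_three]
        linear_combination (x 0 ^ 2 + x 1 ^ 2) * Real.sin_sq_add_cos_sq ψ } rfl

theorem rotZ_apply (ψ : ℝ) (x : Space3) :
    rotZ ψ x = !₂[Real.cos ψ * x 0 - Real.sin ψ * x 1,
      Real.sin ψ * x 0 + Real.cos ψ * x 1, x 2] := rfl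

theorem rotZ_apply_two (ψ : ℝ) (x : Space3) : rotZ ψ x 2 = x 2 := rfl

theorem rotZ_rotZ (ψ φ : ℝ) (x : Space3) : rotZ ψ (rotZ φ x) = rotZ (ψ + φ) x := by
  simp only [rotZ_apply, Real.cos_add, Real.sin_add]
  ext i; fin_cases i <;> simp <;> ring

theorem rotZ_add_two_pi (ψ : ℝ) (x : Space3) : rotZ (ψ + 2 * Real.pi) x = rotZ ψ x := by
  simp only [rotZ_apply, Real.cos_add_two_pi, Real.sin_add_two_pi]

theorem continuous_rotZ : Continuous fun q : ℝ × Space3 => rotZ q.1 q.2 := by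
  simp only [rotZ_apply]
  refine (PiLp.continuous_toLp 2 _).comp (continuous_pi fun i => ?_)
  fin_cases i <;> simp <;> fun_prop

/-- The point of height `t` on the unit sphere on the meridian of the `x`-axis. -/
def meridianPoint (t : ℝ) : Space3 := !₂[Real.sqrt (1 - t ^ 2), 0, t]

theorem exists_rotZ_meridianPoint {x : Space3} (hx : ‖x‖ = 1) :
    ∃ φ, x = rotZ φ (meridianPoint (x 2)) := by
  have hs : x 0 ^ 2 + x 1 ^ 2 + x 2 ^ 2 = 1 := by
    have := EuclideanSpace.real_norm_sq_eq x
    rw [hx, Fin.sum_univ_three] at this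
    linarith
  have hn : ‖(⟨x 0, x 1⟩ : ℂ)‖ = Real.sqrt (1 - x 2 ^ 2) := by
    rw [Complex.norm_def, Complex.normSq_mk]
    congr 1; linarith
  refine ⟨Complex.arg ⟨x 0, x 1⟩, ?_⟩
  have h1 := Complex.norm_mul_cos_arg ⟨x 0, x 1⟩
  have h2 := Complex.norm_mul_sin_arg ⟨x 0, x 1⟩
  rw [hn] at h1 h2
  simp only at h1 h2
  rw [rotZ_apply, meridianPoint]
  ext i; fin_cases i <;> simp
  · linarith
  · linarith

theorem norm_eq_one_of_sq {x : Space3} (h : x 0 ^ 2 + x 1 ^ 2 + x 2 ^ 2 = 1) : ‖x‖ = 1 := by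
  rw [EuclideanSpace.norm_eq, Real.sqrt_eq_one, Fin.sum_univ_three]
  simpa using h

theorem norm_meridianPoint {t : ℝ} (ht : |t| ≤ 1) : ‖meridianPoint t‖ = 1 := by
  apply norm_eq_one_of_sq
  have : 0 ≤ 1 - t ^ 2 := by nlinarith [abs_le.mp ht]
  simp [meridianPoint, Real.sq_sqrt this]

/-- Orthonormal pairs with prescribed heights. -/
theorem exists_orthonormal_heights {a d : ℝ} (h : a ^ 2 + d ^ 2 ≤ 1) :
    ∃ u v : Space3, ‖u‖ = 1 ∧ ‖v‖ = 1 ∧ inner ℝ u v = 0 ∧ u 2 = a ∧ v 2 = d := by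
  have ha : 0 ≤ 1 - a ^ 2 := by nlinarith [sq_nonneg d]
  set s := Real.sqrt (1 - a ^ 2) with hs
  have hs2 : s ^ 2 = 1 - a ^ 2 := Real.sq_sqrt ha
  rcases eq_or_ne s 0 with h0 | h0
  · have hd : d = 0 := by rw [h0] at hs2; nlinarith [sq_nonneg d]
    refine ⟨!₂[0, 0, a], !₂[0, 1, 0], norm_eq_one_of_sq ?_, norm_eq_one_of_sq ?_, ?_, ?_, ?_⟩
    · rw [h0] at hs2
      simp only [Matrix.cons_val]
      linarith
    · simp
    · simp [PiLp.inner_apply, Fin.sum_univ_three]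
    · simp
    · simp [hd]
  · have hspos : 0 < s ^ 2 := by positivity
    have hw : 0 ≤ 1 - d ^ 2 / s ^ 2 := by
      rw [sub_nonneg, div_le_one hspos]; linarith
    -- Orthogonality to `u` forces the first coordinate of `v`; normalization forces the second up
    -- to sign.
    refine ⟨!₂[s, 0, a], !₂[-(a * d) / s, Real.sqrt (1 - d ^ 2 / s ^ 2), d],
      norm_eq_one_of_sq ?_, norm_eq_one_of_sq ?_, ?_, ?_, ?_⟩
    · simp; linarith
    · simp only [Matrix.cons_val]
      rw [Real.sq_sqrt hw]
      field_simp
      rw [hs2]; ring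
    · simp [PiLp.inner_apply, Fin.sum_univ_three]
      field_simp
      ring
    · simp
    · simp

/-- Trines with prescribed heights. -/
theorem exists_trine_heights {a b : ℝ} (h : a ^ 2 + a * b + b ^ 2 ≤ 3 / 4) :
    ∃ x y z : Space3, ‖x‖ = 1 ∧ ‖y‖ = 1 ∧ ‖z‖ = 1 ∧ x + y + z = 0 ∧ x 2 = a ∧ y 2 = b ∧
      z 2 = -a - b := by
  have h3 : Real.sqrt 3 ^ 2 = 3 := Real.sq_sqrt (by norm_num)
  have h30 : Real.sqrt 3 ≠ 0 := by positivity
  -- The height of `v` is chosen so that `-u/2 + (√3/2) v` has height `b`; then `a² + d² ≤ 1` is the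
  -- hypothesis multiplied by 4/3.
  obtain ⟨u, v, hu, hv, huv, hu2, hv2⟩ :=
    exists_orthonormal_heights (a := a) (d := (a + 2 * b) / Real.sqrt 3)
      (by rw [div_pow, h3]; nlinarith)
  have hn : ∀ c : ℝ, c ^ 2 = 3 / 4 → ‖(-1 / 2 : ℝ) • u + c • v‖ = 1 := by
    intro c hc
    rw [← sq_eq_sq₀ (norm_nonneg _) zero_le_one, norm_add_sq_real, norm_smul, norm_smul, hu, hv,
      inner_smul_left, inner_smul_right, huv]
    simp only [Real.norm_eq_abs, mul_one, sq_abs, hc]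
    norm_num
  refine ⟨u, (-1 / 2 : ℝ) • u + (Real.sqrt 3 / 2) • v, (-1 / 2 : ℝ) • u + (-(Real.sqrt 3 / 2)) • v,
    hu, hn _ (by rw [div_pow, h3]; norm_num), hn _ (by rw [neg_sq, div_pow, h3]; norm_num), ?_,
    hu2, ?_, ?_⟩
  · module
  · simp [hu2, hv2]; field_simp; ring
  · simp [hu2, hv2]; field_simp; ring

/-! ### Averages over circles of latitude -/

/-- Continuous functions on space, homogeneous of degree one, that sum to zero over every trine. -/
structure IsTrineNull (g : Space3 → ℝ) : Prop where
  continuous : Continuous g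
  homogeneous : ∀ (r : ℝ) (x : Space3), 0 ≤ r → g (r • x) = r * g x
  abs_le_norm : ∀ x, |g x| ≤ ‖x‖
  sum_eq_zero : ∀ x y z : Space3, ‖x‖ = 1 → ‖y‖ = 1 → ‖z‖ = 1 → x + y + z = 0 →
    g x + g y + g z = 0

namespace IsTrineNull

variable {g : Space3 → ℝ}

theorem comp_isometry (hg : IsTrineNull g) (T : Space3 ≃ₗᵢ[ℝ] Space3) :
    IsTrineNull fun x => g (T x) where
  continuous := hg.continuous.comp T.continuous
  homogeneous r x hr := by rw [map_smul, hg.homogeneous r _ hr]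
  abs_le_norm x := by simpa using hg.abs_le_norm (T x)
  sum_eq_zero x y z hx hy hz h := by
    refine hg.sum_eq_zero _ _ _ ?_ ?_ ?_ ?_
    · rw [T.norm_map, hx]
    · rw [T.norm_map, hy]
    · rw [T.norm_map, hz]
    · rw [← map_add, ← map_add, h, map_zero]

theorem continuous_comp_rotZ (hg : IsTrineNull g) (x : Space3) :
    Continuous fun ψ => g (rotZ ψ x) := by
  have h : Continuous fun ψ : ℝ => rotZ ψ x :=
    continuous_rotZ.comp (f := fun ψ : ℝ => (ψ, x)) (by fun_prop)
  exact hg.continuous.comp h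

/-- A shift of a periodic integrand; it makes the latitude average a function of height alone. -/
theorem integral_rotZ_rotZ (φ : ℝ) (x : Space3) :
    ∫ ψ in (0 : ℝ)..2 * Real.pi, g (rotZ ψ (rotZ φ x)) =
      ∫ ψ in (0 : ℝ)..2 * Real.pi, g (rotZ ψ x) := by
  have hper : Function.Periodic (fun ψ => g (rotZ ψ x)) (2 * Real.pi) := fun ψ => by
    simp only [rotZ_add_two_pi]
  simp only [rotZ_rotZ]
  rw [intervalIntegral.integral_comp_add_right (fun ψ => g (rotZ ψ x)) φ]
  have := hper.intervalIntegral_add_eq φ 0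
  rw [zero_add] at this
  rw [zero_add, add_comm (2 * Real.pi), this]

/-- The average over a circle of latitude is the height times the value at the pole. -/
theorem integral_rotZ_of_norm_eq_one (hg : IsTrineNull g) {x : Space3} (hx : ‖x‖ = 1) :
    ∫ ψ in (0 : ℝ)..2 * Real.pi, g (rotZ ψ x) = x 2 * (2 * Real.pi * g !₂[0, 0, 1]) := by
  -- The value 0 outside `[-1, 1]` only serves to make the bound on `h` global.
  set h : ℝ → ℝ := fun t =>
    if |t| ≤ 1 then ∫ ψ in (0 : ℝ)..2 * Real.pi, g (rotZ ψ (meridianPoint t)) else 0 with hh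
  have habs : ∀ y : Space3, ‖y‖ = 1 → |y 2| ≤ 1 := fun y hy => by
    simpa [hy] using PiLp.norm_apply_le y 2
  have hval : ∀ y : Space3, ‖y‖ = 1 → h (y 2) = ∫ ψ in (0 : ℝ)..2 * Real.pi, g (rotZ ψ y) := by
    intro y hy
    obtain ⟨φ, hφ⟩ := exists_rotZ_meridianPoint hy
    rw [hh]
    simp only [habs y hy, if_true]
    conv_rhs => rw [hφ]
    rw [integral_rotZ_rotZ]
  have hbound : ∀ t, |h t| ≤ 2 * Real.pi := by
    intro t
    rw [hh]
    by_cases ht : |t| ≤ 1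
    · simp only [ht, if_true]
      have := intervalIntegral.norm_integral_le_of_norm_le_const (a := 0) (b := 2 * Real.pi)
        (f := fun ψ => g (rotZ ψ (meridianPoint t))) (C := 1) (fun ψ _ => by
          have := hg.abs_le_norm (rotZ ψ (meridianPoint t))
          rwa [LinearIsometryEquiv.norm_map, norm_meridianPoint ht] at this)
      rwa [sub_zero, one_mul, abs_of_pos Real.two_pi_pos] at this
    · simp only [ht, if_false, abs_zero]
      exact Real.two_pi_pos.le
  have hadd : ∀ a b, a ^ 2 + a * b + b ^ 2 ≤ 3 / 4 → h a + h b + h (-a - b) = 0 := by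
    intro a b hab
    obtain ⟨x, y, z, hx, hy, hz, hs, rfl, rfl, hz2⟩ := exists_trine_heights hab
    have cx := hg.continuous_comp_rotZ x
    have cy := hg.continuous_comp_rotZ y
    have cz := hg.continuous_comp_rotZ z
    have cxy : Continuous fun ψ => g (rotZ ψ x) + g (rotZ ψ y) := cx.add cy
    rw [← hz2, hval x hx, hval y hy, hval z hz,
      ← intervalIntegral.integral_add (cx.intervalIntegrable _ _) (cy.intervalIntegrable _ _),
      ← intervalIntegral.integral_add (cxy.intervalIntegrable _ _) (cz.intervalIntegrable _ _)]
    refine intervalIntegral.integral_zero_ae (Filter.Eventually.of_forall fun ψ _ => ?_)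
    refine (hg.comp_isometry (rotZ ψ)).sum_eq_zero x y z hx hy hz hs
  have hone : h 1 = 2 * Real.pi * g !₂[0, 0, 1] := by
    have e := hval !₂[0, 0, 1] (norm_eq_one_of_sq (by simp))
    simp only [Matrix.cons_val] at e
    rw [e]
    have : ∀ ψ, rotZ ψ !₂[0, 0, 1] = !₂[0, 0, 1] := fun ψ => by simp [rotZ_apply]
    simp [this]
  rw [← hval x hx, eq_mul_of_locally_additive hbound hadd (habs x hx), hone]

theorem integral_rotZ (hg : IsTrineNull g) (x : Space3) :
    ∫ ψ in (0 : ℝ)..2 * Real.pi, g (rotZ ψ x) = x 2 * (2 * Real.pi * g !₂[0, 0, 1]) := by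
  rcases eq_or_ne x 0 with rfl | hx
  · have h0 : g 0 = 0 := by simpa using hg.abs_le_norm 0
    simp [h0]
  · have hn : ‖x‖ ≠ 0 := norm_ne_zero_iff.mpr hx
    have hx' : x = ‖x‖ • (‖x‖⁻¹ • x) := by rw [smul_smul, mul_inv_cancel₀ hn, one_smul]
    have h1 : ‖‖x‖⁻¹ • x‖ = 1 := by rw [norm_smul, norm_inv, norm_norm, inv_mul_cancel₀ hn]
    have e := hg.integral_rotZ_of_norm_eq_one h1
    conv_lhs => rw [hx']
    simp only [map_smul, hg.homogeneous _ _ (norm_nonneg x)] at e ⊢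
    rw [intervalIntegral.integral_const_mul]
    simp only [PiLp.smul_apply, smul_eq_mul] at e ⊢
    rw [e]
    field_simp

end IsTrineNull

/-! ### Weighted moments and linearity -/

/-- A radial weight supported in the unit ball. -/
def ballWeight (x : Space3) : ℝ := max 0 (1 - ‖x‖)

theorem continuous_ballWeight : Continuous ballWeight := by
  unfold ballWeight; fun_prop

theorem ballWeight_nonneg (x : Space3) : 0 ≤ ballWeight x := le_max_left _ _

theorem ballWeight_isometry (T : Space3 ≃ₗᵢ[ℝ] Space3) (x : Space3) :
    ballWeight (T x) = ballWeight x := by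
  unfold ballWeight; rw [T.norm_map]

theorem hasCompactSupport_ballWeight : HasCompactSupport ballWeight := by
  refine HasCompactSupport.intro (isCompact_closedBall (0 : Space3) 1) fun x hx => ?_
  rw [mem_closedBall_zero_iff, not_le] at hx
  exact max_eq_left (by linarith)

theorem integrable_ballWeight_mul {k : Space3 → ℝ} (hk : Continuous k) :
    MeasureTheory.Integrable fun x => ballWeight x * k x :=
  (continuous_ballWeight.mul hk).integrable_of_hasCompactSupport
    hasCompactSupport_ballWeight.mul_right

theorem integral_comp_isometry (T : Space3 ≃ₗᵢ[ℝ] Space3) (k : Space3 → ℝ) :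
    ∫ x, k (T x) = ∫ x, k x :=
  T.measurePreserving.integral_comp T.toHomeomorph.measurableEmbedding k

theorem integral_ballWeight_mul_sq_pos : 0 < ∫ x : Space3, ballWeight x * x 2 ^ 2 := by
  have hc : Continuous fun x : Space3 => x 2 ^ 2 := by fun_prop
  refine (continuous_ballWeight.mul hc).integral_pos_of_hasCompactSupport_nonneg_nonzero
    hasCompactSupport_ballWeight.mul_right
    (fun x => mul_nonneg (ballWeight_nonneg x) (sq_nonneg _)) (x := !₂[0, 0, 1 / 2]) ?_
  have : ‖(!₂[0, 0, 1 / 2] : Space3)‖ = 1 / 2 := by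
    rw [EuclideanSpace.norm_eq, Fin.sum_univ_three]
    simp
  simp only [ballWeight, this, Matrix.cons_val]
  norm_num

namespace IsTrineNull

variable {g : Space3 → ℝ}

/-- Weight, height and volume are invariant under rotations about the axis, so `g` may be replaced
by its rotations; Fubini then brings in the latitude average. -/
theorem integral_mul_height (hg : IsTrineNull g) :
    ∫ x : Space3, ballWeight x * (x 2 * g x) =
      (∫ x : Space3, ballWeight x * x 2 ^ 2) * g !₂[0, 0, 1] := by
  have hrot : ∀ ψ, ∫ x : Space3, ballWeight x * (x 2 * g (rotZ ψ x)) =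
      ∫ x : Space3, ballWeight x * (x 2 * g x) := fun ψ => by
    have := integral_comp_isometry (rotZ ψ) fun x => ballWeight x * (x 2 * g x)
    simpa only [ballWeight_isometry, rotZ_apply_two] using this
  have hint : MeasureTheory.Integrable
      (Function.uncurry fun (ψ : ℝ) (x : Space3) => ballWeight x * (x 2 * g (rotZ ψ x)))
      ((MeasureTheory.volume.restrict (Set.uIoc 0 (2 * Real.pi))).prod MeasureTheory.volume) := by
    have hk : MeasureTheory.Integrable fun x : Space3 => ballWeight x * ‖x‖ ^ 2 :=
      integrable_ballWeight_mul (by fun_prop)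
    have : MeasureTheory.IsFiniteMeasure
        (MeasureTheory.volume.restrict (Set.uIoc 0 (2 * Real.pi))) :=
      inferInstanceAs (MeasureTheory.IsFiniteMeasure
        (MeasureTheory.volume.restrict (Set.Ioc _ _)))
    refine MeasureTheory.Integrable.mono' (hk.comp_snd _) ?_ ?_
    · refine Continuous.aestronglyMeasurable ?_
      refine (continuous_ballWeight.comp continuous_snd).mul (Continuous.mul ?_ ?_)
      · fun_prop
      · exact hg.continuous.comp continuous_rotZ
    · refine Filter.Eventually.of_forall fun q => ?_
      simp only [Function.uncurry, norm_mul, Real.norm_eq_abs, abs_of_nonneg (ballWeight_nonneg _)]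
      refine mul_le_mul_of_nonneg_left ?_ (ballWeight_nonneg _)
      rw [sq]
      refine mul_le_mul (PiLp.norm_apply_le q.2 2) ?_ (abs_nonneg _) (norm_nonneg _)
      simpa using hg.abs_le_norm (rotZ q.1 q.2)
  have hswap := MeasureTheory.intervalIntegral_integral_swap hint
  simp only [hrot, intervalIntegral.integral_const_mul, hg.integral_rotZ] at hswap
  rw [intervalIntegral.integral_const, sub_zero, smul_eq_mul] at hswap
  have e : ∀ x : Space3, ballWeight x * (x 2 * (x 2 * (2 * Real.pi * g !₂[0, 0, 1]))) =
      (2 * Real.pi * g !₂[0, 0, 1]) * (ballWeight x * x 2 ^ 2) := fun x => by ring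
  simp only [e] at hswap
  rw [MeasureTheory.integral_const_mul] at hswap
  have := Real.two_pi_pos.ne'
  apply mul_left_cancel₀ this
  rw [hswap]; ring

theorem integral_mul_inner (hg : IsTrineNull g) {p : Space3} (hp : ‖p‖ = 1) :
    ∫ x : Space3, ballWeight x * (inner ℝ x p * g x) =
      (∫ x : Space3, ballWeight x * x 2 ^ 2) * g p := by
  set e : Space3 := !₂[0, 0, 1]
  have he : ‖e‖ = 1 := norm_eq_one_of_sq (by simp [e])
  -- The reflection in the plane orthogonal to `e - p` serves, since the hypotheses on `g` are
  -- invariant under improper isometries too.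
  obtain ⟨T, hT⟩ : ∃ T : Space3 ≃ₗᵢ[ℝ] Space3, T e = p :=
    ⟨(Submodule.span ℝ {e - p})ᗮ.reflection, Submodule.reflection_sub (he.trans hp.symm)⟩
  rw [← integral_comp_isometry T]
  have h2 : ∀ x, inner ℝ (T x) p = x 2 := fun x => by
    rw [← hT, T.inner_map_map]
    simp [e, PiLp.inner_apply, Fin.sum_univ_three]
  simp only [ballWeight_isometry, h2]
  rw [(hg.comp_isometry T).integral_mul_height, hT]

/-- Functions that vanish on trines are linear. -/
theorem exists_eq_inner (hg : IsTrineNull g) :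
    ∃ V : Space3, ∀ p : Space3, ‖p‖ = 1 → g p = inner ℝ p V := by
  set C := ∫ x : Space3, ballWeight x * x 2 ^ 2
  have hC : 0 < C := integral_ballWeight_mul_sq_pos
  -- `V` is the vector of first moments of `g`, normalized by `C`.
  refine ⟨WithLp.toLp 2 fun i => C⁻¹ * ∫ x : Space3, ballWeight x * (x i * g x), fun p hp => ?_⟩
  have hi : ∀ i : Fin 3, MeasureTheory.Integrable fun x : Space3 =>
      p i * (ballWeight x * (x i * g x)) := fun i =>
    (integrable_ballWeight_mul ((by fun_prop : Continuous fun x : Space3 => x i).mul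
      hg.continuous)).const_mul _
  have h1 := hg.integral_mul_inner hp
  have h2 : ∀ x : Space3, ballWeight x * (inner ℝ x p * g x) =
      ∑ i, p i * (ballWeight x * (x i * g x)) := fun x => by
    simp [PiLp.inner_apply, Fin.sum_univ_three]; ring
  simp only [h2] at h1
  rw [MeasureTheory.integral_finsetSum _ fun i _ => hi i] at h1
  simp only [MeasureTheory.integral_const_mul] at h1
  rw [← mul_left_cancel_iff_of_pos hC, ← h1]
  simp only [PiLp.inner_apply, Fin.sum_univ_three, RCLike.inner_apply, conj_trivial]
  field_simp

end IsTrineNull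

/-! ### The harmonics with `m = l` on the `xz` trine -/

open Polynomial in
-- The polynomial `(X² - 1)^l` is monic of degree `2l`, so only its leading term survives `2l`
-- derivatives.
theorem legendreFactor_self (l : ℕ) :
    legendreFactor l l =
      C ((-1) ^ l / (2 ^ l * (l.factorial : ℝ)) * ((2 * l).factorial : ℝ)) := by
  have hdeg : ((X ^ 2 - 1 : ℝ[X]) ^ l).natDegree = 2 * l := by
    rw [natDegree_pow, ← C_1, natDegree_X_pow_sub_C, mul_comm]
  have hmonic : ((X ^ 2 - 1 : ℝ[X]) ^ l).Monic := by
    rw [← C_1]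
    exact (monic_X_pow_sub_C 1 two_ne_zero).pow l
  have hd : derivative^[l + l] ((X ^ 2 - 1 : ℝ[X]) ^ l) = C ((2 * l).factorial : ℝ) := by
    ext k
    rw [coeff_iterate_derivative, coeff_C, ← two_mul]
    split_ifs with hk
    · subst hk
      rw [zero_add, Nat.descFactorial_self, ← hdeg, coeff_natDegree, hmonic.leadingCoeff, hdeg]
      simp
    · rw [coeff_eq_zero_of_natDegree_lt (by omega), smul_zero]
  rw [legendreFactor, hd, C_mul]

theorem exists_sphericalHarmonic_self (l : ℕ) : ∃ κ : ℂ, κ ≠ 0 ∧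
    ∀ n : UnitSphere, sphericalHarmonic l l n =
      κ * ((((n : Space3) 0 : ℝ) : ℂ) + Complex.I * (((n : Space3) 1 : ℝ) : ℂ)) ^ l := by
  refine ⟨((Real.sqrt ((2 * l + 1) / (4 * Real.pi) *
      (((l - l).factorial : ℝ) / ((l + l).factorial : ℝ))) *
      ((-1) ^ l / (2 ^ l * (l.factorial : ℝ)) * ((2 * l).factorial : ℝ)) : ℝ) : ℂ), ?_, ?_⟩
  · rw [Complex.ofReal_ne_zero]
    refine mul_ne_zero (Real.sqrt_pos.mpr ?_).ne' ?_
    · have := Real.pi_pos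
      positivity
    · have : ((-1 : ℝ)) ^ l ≠ 0 := pow_ne_zero _ (by norm_num)
      positivity
  · intro n
    simp only [sphericalHarmonic, Int.natCast_nonneg, if_true, Int.natAbs_natCast,
      sphericalHarmonicNat, legendreFactor_self, Polynomial.eval_C]

/-- All `y` coordinates vanish, leaving `1 + 2 (-1/2)^l`. The integer exponent makes the formula
correct at `l = 0`. -/
theorem sum_xzTrine_pow (κ : ℂ) (l : ℕ) :
    ∑ j, κ * ((((xzTrine j : Space3) 0 : ℝ) : ℂ) +
      Complex.I * (((xzTrine j : Space3) 1 : ℝ) : ℂ)) ^ l =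
      κ * (1 + (-1) ^ l / 2 ^ ((l : ℤ) - 1)) := by
  rw [zpow_sub_one₀ two_ne_zero, zpow_natCast]
  simp [Fin.sum_univ_three, xzTrine, div_pow]
  field_simp
  ring

theorem one_add_neg_one_pow_div_ne_zero_iff (l : ℕ) :
    (1 + (-1) ^ l / 2 ^ ((l : ℤ) - 1) : ℂ) ≠ 0 ↔ l ≠ 1 := by
  constructor
  · rintro h rfl
    norm_num at h
  · intro hl h
    obtain rfl | ⟨k, rfl⟩ : l = 0 ∨ ∃ k, l = k + 2 := by
      rcases l with _ | _ | k
      · exact Or.inl rfl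
      · exact absurd rfl hl
      · exact Or.inr ⟨k, rfl⟩
    · norm_num at h
    · have h1 : ((-1 : ℂ)) ^ (k + 2) / 2 ^ (((k + 2 : ℕ) : ℤ) - 1) = -1 := by
        linear_combination h
      have h2 := congrArg norm h1
      rw [norm_div, norm_pow, norm_neg, norm_one, one_pow, norm_zpow,
        show (((k + 2 : ℕ) : ℤ) - 1) = ((k + 1 : ℕ) : ℤ) by push_cast; ring, zpow_natCast,
        Complex.norm_two, div_eq_one_iff_eq (by positivity)] at h2
      have h3 : (1 : ℝ) < 2 ^ (k + 1) := one_lt_pow₀ one_lt_two (by omega)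
      linarith

/-! ### Trines as unit triples with sum zero -/

theorem angle_eq_iff_inner {u v : Space3} (hu : ‖u‖ = 1) (hv : ‖v‖ = 1) :
    InnerProductGeometry.angle u v = 2 * Real.pi / 3 ↔ inner ℝ u v = -1 / 2 := by
  have hcos : Real.cos (2 * Real.pi / 3) = -1 / 2 := by
    rw [show 2 * Real.pi / 3 = Real.pi - Real.pi / 3 by ring, Real.cos_pi_sub,
      Real.cos_pi_div_three]
    norm_num
  constructor
  · intro h
    rw [InnerProductGeometry.inner_eq_cos_angle_of_norm_eq_one hu hv, h, hcos]
  · intro h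
    rw [InnerProductGeometry.angle, hu, hv, h, mul_one, div_one, ← hcos, Real.arccos_cos]
    · positivity
    · linarith [Real.pi_pos]

theorem norm_coe_unitSphere (n : UnitSphere) : ‖(n : Space3)‖ = 1 :=
  mem_sphere_zero_iff_norm.mp n.2

theorem isTrine_xzTrine : IsTrine xzTrine := by
  have h3 : Real.sqrt 3 * Real.sqrt 3 = 3 := Real.mul_self_sqrt (by norm_num)
  intro i j hij
  rw [angle_eq_iff_inner (norm_coe_unitSphere _) (norm_coe_unitSphere _)]
  fin_cases i <;> fin_cases j <;>
    simp [xzTrine, PiLp.inner_apply, Fin.sum_univ_three] at hij ⊢ <;> nlinarith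

/-- The squared norm of the sum is `3 + 6 · (-1/2) = 0`. -/
theorem IsTrine.sum_eq_zero {n : Fin 3 → UnitSphere} (h : IsTrine n) :
    (n 0 : Space3) + n 1 + n 2 = 0 := by
  have hi : ∀ i j, i ≠ j → inner ℝ (n i : Space3) (n j) = -1 / 2 := fun i j hij =>
    (angle_eq_iff_inner (norm_coe_unitSphere _) (norm_coe_unitSphere _)).mp (h i j hij)
  rw [← norm_eq_zero, ← sq_eq_zero_iff, norm_add_sq_real, norm_add_sq_real, inner_add_left,
    hi 0 1 (by decide), hi 0 2 (by decide), hi 1 2 (by decide)]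
  simp only [norm_coe_unitSphere]
  norm_num

theorem inner_eq_of_add_eq_zero {x y z : Space3} (hx : ‖x‖ = 1) (hy : ‖y‖ = 1) (hz : ‖z‖ = 1)
    (h : x + y + z = 0) : inner ℝ x y = -1 / 2 := by
  have h1 : ‖x + y‖ ^ 2 = 1 := by
    rw [eq_neg_of_add_eq_zero_left h, norm_neg, hz, one_pow]
  rw [norm_add_sq_real, hx, hy] at h1
  linarith

theorem isTrine_of_add_eq_zero {x y z : UnitSphere} (h : (x : Space3) + y + z = 0) :
    IsTrine ![x, y, z] := by
  have hx := norm_coe_unitSphere x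
  have hy := norm_coe_unitSphere y
  have hz := norm_coe_unitSphere z
  have h1 := inner_eq_of_add_eq_zero hx hy hz h
  have h2 := inner_eq_of_add_eq_zero hx hz hy (by rw [add_right_comm]; exact h)
  have h3 := inner_eq_of_add_eq_zero hy hz hx (by rw [add_rotate, add_rotate]; exact h)
  intro i j hij
  rw [angle_eq_iff_inner (norm_coe_unitSphere _) (norm_coe_unitSphere _)]
  fin_cases i <;> fin_cases j <;> simp [h1, h2, h3, real_inner_comm] at hij ⊢

/-! ### Bloch operators and the trace rule -/

theorem effectOp_trace_mul (n : UnitSphere) (P : Space3) :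
    (((1 / 2 : ℂ) • (1 + ∑ k, ((P k : ℝ) : ℂ) • pauli k)) * effectOp n).trace =
      (((1 + inner ℝ (n : Space3) P) / 3 : ℝ) : ℂ) := by
  simp [effectOp, pauli, Matrix.trace_fin_two, Fin.sum_univ_three, PiLp.inner_apply,
    Matrix.mul_apply, Matrix.one_apply, Fin.sum_univ_two]
  ring_nf
  simp
  ring

theorem isTrineFrameFunction_of_eq {f : trineEffects → ℝ} {P : Space3} (hP : ‖P‖ ≤ 1)
    (hf : ∀ n : UnitSphere, onSphere f n = (1 + inner ℝ (n : Space3) P) / 3) :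
    IsTrineFrameFunction f ∧ Continuous (onSphere f) := by
  refine ⟨⟨?_, ?_⟩, ?_⟩
  · rintro ⟨_, n, rfl⟩
    have h1 : |inner ℝ (n : Space3) P| ≤ 1 := by
      refine (abs_real_inner_le_norm _ _).trans ?_
      rwa [norm_coe_unitSphere, one_mul]
    have h2 := abs_le.mp h1
    change onSphere f n ∈ _
    rw [hf n]
    constructor <;> linarith
  · rintro X ⟨n, hn, hX⟩
    have h (j) : f (X j) = (1 + inner ℝ (n j : Space3) P) / 3 := by rw [hX j]; exact hf (n j)
    have h0 : inner ℝ (n 0 : Space3) P + inner ℝ (n 1 : Space3) P + inner ℝ (n 2 : Space3) P = 0 := by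
      rw [← inner_add_left, ← inner_add_left, hn.sum_eq_zero, inner_zero_left]
    simp only [h, Fin.sum_univ_three]
    linarith
  · rw [funext hf]
    fun_prop

/-- With `d = √(1 - ‖P‖²)` and `M = (1 + d) + P · σ`, the identity `(P · σ)² = ‖P‖² = 1 - d²` gives
`M² = 2 (1 + d) (1 + P · σ)`, so the Hermitian `M` is a multiple of a square root. -/
theorem posSemidef_blochOp {P : Space3} (hP : ‖P‖ ≤ 1) :
    ((1 / 2 : ℂ) • (1 + ∑ k, ((P k : ℝ) : ℂ) • pauli k) : QubitOp).PosSemidef := by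
  have hn : P 0 ^ 2 + P 1 ^ 2 + P 2 ^ 2 ≤ 1 := by
    have := EuclideanSpace.real_norm_sq_eq P
    rw [Fin.sum_univ_three] at this
    rw [← this]
    exact pow_le_one₀ (norm_nonneg _) hP
  set d := Real.sqrt (1 - (P 0 ^ 2 + P 1 ^ 2 + P 2 ^ 2)) with hd
  have hd0 : 0 ≤ d := Real.sqrt_nonneg _
  have hd2 : d ^ 2 = 1 - (P 0 ^ 2 + P 1 ^ 2 + P 2 ^ 2) := Real.sq_sqrt (by linarith)
  have hd2' : (d : ℂ) ^ 2 = 1 - ((P 0 : ℂ) ^ 2 + (P 1 : ℂ) ^ 2 + (P 2 : ℂ) ^ 2) := by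
    exact_mod_cast congrArg (fun r : ℝ => (r : ℂ)) hd2
  have hs : ((1 + d : ℝ) : ℂ) ≠ 0 := Complex.ofReal_ne_zero.mpr (by linarith)
  set M : QubitOp := ((1 + d : ℝ) : ℂ) • (1 : QubitOp) + ∑ k, ((P k : ℝ) : ℂ) • pauli k with hM
  have key : ((1 / 2 : ℂ) • (1 + ∑ k, ((P k : ℝ) : ℂ) • pauli k) : QubitOp) =
      (((1 / (4 * (1 + d)) : ℝ)) : ℂ) • (M.conjTranspose * M) := by
    push_cast at hs ⊢
    ext i j
    fin_cases i <;> fin_cases j <;>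
      simp [hM, pauli, Fin.sum_univ_three, Matrix.mul_apply, Matrix.one_apply, Fin.sum_univ_two] <;>
      field_simp <;> ring_nf <;> simp only [Complex.I_sq, hd2'] <;> ring
  rw [key]
  refine (Matrix.posSemidef_conjTranspose_mul_self M).smul ?_
  rw [Complex.zero_le_real]
  positivity

theorem trace_blochOp (P : Space3) :
    ((1 / 2 : ℂ) • (1 + ∑ k, ((P k : ℝ) : ℂ) • pauli k) : QubitOp).trace = 1 := by
  simp [pauli, Matrix.trace_fin_two, Fin.sum_univ_three]

theorem trace_blochOp_mul_pauli (P : Space3) (j : Fin 3) :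
    (((1 / 2 : ℂ) • (1 + ∑ k, ((P k : ℝ) : ℂ) • pauli k) : QubitOp) * pauli j).trace = P j := by
  fin_cases j <;>
    simp [pauli, Matrix.trace_fin_two, Fin.sum_univ_three, Matrix.mul_apply, Matrix.one_apply,
      Fin.sum_univ_two] <;> ring_nf <;> simp

theorem norm_le_one_of_inner {P : Space3}
    (h : ∀ n : UnitSphere, 0 ≤ (1 + inner ℝ (n : Space3) P) / 3) : ‖P‖ ≤ 1 := by
  rcases eq_or_ne P 0 with rfl | hP
  · simp
  have hn : ‖P‖ ≠ 0 := norm_ne_zero_iff.mpr hP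
  -- The direction opposite to `P` minimizes the affine function, with value `(1 - ‖P‖) / 3`.
  have := h ⟨-(‖P‖⁻¹ • P), by
    rw [mem_sphere_zero_iff_norm, norm_neg, norm_smul, norm_inv, norm_norm, inv_mul_cancel₀ hn]⟩
  simp only [inner_neg_left, inner_smul_left, real_inner_self_eq_norm_sq, conj_trivial] at this
  rw [sq, inv_mul_cancel_left₀ hn] at this
  linarith

/-! ### From frame functions to linear forms -/

theorem exists_isTrineNull {F : UnitSphere → ℝ} (hF : Continuous F)
    (hmem : ∀ n, F n ∈ Set.Icc (0 : ℝ) 1)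
    (hsum : ∀ n : Fin 3 → UnitSphere, IsTrine n → ∑ j, F (n j) = 1) :
    ∃ g : Space3 → ℝ, IsTrineNull g ∧ ∀ n : UnitSphere, g n = F n - 1 / 3 := by
  -- A Tietze extension lets `x / ‖x‖` be inserted without a membership proof; at the origin the
  -- factor `‖x‖` removes its value.
  obtain ⟨G, hG⟩ := ContinuousMap.exists_restrict_eq
    (Metric.isClosed_sphere (x := (0 : Space3)) (ε := 1)) ⟨F, hF⟩
  have hG' : ∀ n : UnitSphere, G n = F n := fun n => congrArg (fun k => k n) hG
  set g : Space3 → ℝ := fun x => ‖x‖ * (G (‖x‖⁻¹ • x) - 1 / 3) with hg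
  have hval : ∀ n : UnitSphere, g n = F n - 1 / 3 := fun n => by
    simp [hg, hG']
  have habs : ∀ x, |g x| ≤ ‖x‖ := by
    intro x
    rcases eq_or_ne x 0 with rfl | hx
    · simp [hg]
    have hn : ‖x‖ ≠ 0 := norm_ne_zero_iff.mpr hx
    have e := hG' ⟨‖x‖⁻¹ • x, by
      rw [mem_sphere_zero_iff_norm, norm_smul, norm_inv, norm_norm, inv_mul_cancel₀ hn]⟩
    simp only at e
    simp only [hg]
    rw [abs_mul, abs_norm, e]
    refine mul_le_of_le_one_right (norm_nonneg _) ?_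
    have := hmem ⟨‖x‖⁻¹ • x, by
      rw [mem_sphere_zero_iff_norm, norm_smul, norm_inv, norm_norm, inv_mul_cancel₀ hn]⟩
    rw [abs_le]
    constructor <;> linarith [this.1, this.2]
  refine ⟨g, ⟨?_, ?_, habs, ?_⟩, hval⟩
  · rw [continuous_iff_continuousAt]
    intro x
    rcases eq_or_ne x 0 with rfl | hx
    · have h0 : g 0 = 0 := by simp [hg]
      rw [ContinuousAt, h0]
      refine squeeze_zero_norm habs ?_
      simpa using (continuous_norm (E := Space3)).tendsto 0
    · have hn : ‖x‖ ≠ 0 := norm_ne_zero_iff.mpr hx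
      refine continuous_norm.continuousAt.mul (ContinuousAt.sub ?_ continuousAt_const)
      exact G.continuous.continuousAt.comp
        ((continuous_norm.continuousAt.inv₀ hn).smul continuousAt_id)
  · intro r x hr
    rcases hr.eq_or_lt with rfl | hr
    · simp [hg]
    · simp only [hg, norm_smul, Real.norm_eq_abs, abs_of_pos hr, smul_smul]
      rw [show (r * ‖x‖)⁻¹ * r = ‖x‖⁻¹ by field_simp]
      ring
  · intro x y z hx hy hz h
    have hx' : x ∈ Metric.sphere (0 : Space3) 1 := mem_sphere_zero_iff_norm.mpr hx
    have hy' : y ∈ Metric.sphere (0 : Space3) 1 := mem_sphere_zero_iff_norm.mpr hy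
    have hz' : z ∈ Metric.sphere (0 : Space3) 1 := mem_sphere_zero_iff_norm.mpr hz
    have e := hsum ![⟨x, hx'⟩, ⟨y, hy'⟩, ⟨z, hz'⟩] (isTrine_of_add_eq_zero h)
    simp only [Fin.sum_univ_three, Matrix.cons_val] at e
    have e1 := hval ⟨x, hx'⟩
    have e2 := hval ⟨y, hy'⟩
    have e3 := hval ⟨z, hz'⟩
    simp only at e1 e2 e3
    linarith

theorem IsTrineFrameFunction.exists_eq_inner {f : trineEffects → ℝ} (hf : IsTrineFrameFunction f)
    (hc : Continuous (onSphere f)) :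
    ∃ P : Space3, ‖P‖ ≤ 1 ∧ ∀ n : UnitSphere, onSphere f n = (1 + inner ℝ (n : Space3) P) / 3 := by
  obtain ⟨g, hg, hval⟩ := exists_isTrineNull hc (fun n => hf.mem_Icc _) fun n hn =>
    hf.sum_eq_one (fun j => trineEffect (n j)) ⟨n, hn, fun _ => rfl⟩
  obtain ⟨V, hV⟩ := hg.exists_eq_inner
  have h : ∀ n : UnitSphere, onSphere f n = (1 + inner ℝ (n : Space3) ((3 : ℝ) • V)) / 3 := by
    intro n
    have e := hval n
    rw [hV n (norm_coe_unitSphere n)] at e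
    rw [inner_smul_right]
    linarith
  exact ⟨(3 : ℝ) • V, norm_le_one_of_inner fun n => h n ▸ (hf.mem_Icc _).1, h⟩

/-! ### Vanishing of the harmonic coefficients for `l ≥ 2` -/

theorem integral_exp_int_mul_I {j : ℤ} (hj : j ≠ 0) :
    ∫ φ in (0 : ℝ)..2 * Real.pi, Complex.exp (j * φ * Complex.I) = 0 := by
  have hc : (j * Complex.I : ℂ) ≠ 0 := mul_ne_zero (Int.cast_ne_zero.mpr hj) Complex.I_ne_zero
  have h := integral_exp_mul_complex (a := 0) (b := 2 * Real.pi) hc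
  have e : Complex.exp (j * Complex.I * (2 * Real.pi : ℝ)) = 1 := by
    rw [Complex.exp_eq_one_iff]
    exact ⟨j, by push_cast; ring⟩
  rw [e] at h
  simp only [Complex.ofReal_zero, mul_zero, Complex.exp_zero, sub_self, zero_div] at h
  rw [← h]
  refine intervalIntegral.integral_congr fun φ _ => ?_
  ring_nf

theorem integral_exp_mul_cos_add_sin {m : ℤ} (hm : m.natAbs ≠ 1) (a b : ℝ) :
    ∫ φ in (0 : ℝ)..2 * Real.pi, Complex.exp (-(m * φ * Complex.I)) *
      ((Real.cos φ * a + Real.sin φ * b : ℝ) : ℂ) = 0 := by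
  have e : ∀ φ : ℝ, Complex.exp (-(m * φ * Complex.I)) *
      ((Real.cos φ * a + Real.sin φ * b : ℝ) : ℂ) =
      (a - b * Complex.I) / 2 * Complex.exp ((1 - m : ℤ) * φ * Complex.I) +
      (a + b * Complex.I) / 2 * Complex.exp ((-1 - m : ℤ) * φ * Complex.I) := fun φ => by
    have h1 : Complex.exp ((1 - m : ℤ) * φ * Complex.I) =
        Complex.exp (-(m * φ * Complex.I)) * Complex.exp (φ * Complex.I) := by
      rw [← Complex.exp_add]; push_cast; ring_nf
    have h2 : Complex.exp ((-1 - m : ℤ) * φ * Complex.I) =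
        Complex.exp (-(m * φ * Complex.I)) * Complex.exp (-φ * Complex.I) := by
      rw [← Complex.exp_add]; push_cast; ring_nf
    rw [h1, h2]
    push_cast
    rw [Complex.cos, Complex.sin]
    ring
  simp only [e]
  rw [intervalIntegral.integral_add (Continuous.intervalIntegrable (by fun_prop) _ _)
      (Continuous.intervalIntegrable (by fun_prop) _ _),
    intervalIntegral.integral_const_mul, intervalIntegral.integral_const_mul,
    integral_exp_int_mul_I (by omega), integral_exp_int_mul_I (by omega)]
  simp

/-- The substitution `x = cos θ`; integrations by parts below reduce to exhibiting an antiderivative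
`R`. -/
theorem integral_derivative_eval_cos (R : Polynomial ℝ) :
    ∫ θ in (0 : ℝ)..Real.pi, R.derivative.eval (Real.cos θ) * Real.sin θ =
      R.eval 1 - R.eval (-1) := by
  have hd : ∀ θ ∈ Set.uIcc 0 Real.pi, HasDerivAt (fun θ => -R.eval (Real.cos θ))
      (R.derivative.eval (Real.cos θ) * Real.sin θ) θ := fun θ _ => by
    have := ((R.hasDerivAt (Real.cos θ)).comp θ (Real.hasDerivAt_cos θ)).neg
    refine this.congr_deriv ?_
    ring
  rw [intervalIntegral.integral_eq_sub_of_hasDerivAt hd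
    (Continuous.intervalIntegrable (by fun_prop) _ _), Real.cos_pi, Real.cos_zero]
  ring

/-- The derivatives of `(x^2 - 1)^l`, which are the associated Legendre functions up to
factors. -/
def rodrigues (l k : ℕ) : Polynomial ℝ :=
  Polynomial.derivative^[k] ((Polynomial.X ^ 2 - 1) ^ l)

theorem derivative_rodrigues (l k : ℕ) :
    (rodrigues l k).derivative = rodrigues l (k + 1) :=
  (Function.iterate_succ_apply' _ _ _).symm

/-- The points `±1` are zeros of order `l` of `(x² - 1)^l`, and each derivative lowers the order by
one. -/
theorem eval_rodrigues_eq_zero {l k : ℕ} (h : k < l) {x : ℝ} (hx : x ^ 2 = 1) :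
    (rodrigues l k).eval x = 0 := by
  obtain ⟨q, hq⟩ := Polynomial.pow_sub_dvd_iterate_derivative_pow
    (Polynomial.X ^ 2 - 1 : Polynomial ℝ) l k
  rw [rodrigues, hq, Polynomial.eval_mul, Polynomial.eval_pow]
  simp [hx, Nat.sub_ne_zero_of_lt h]

theorem integral_rodrigues_mul_linear {l : ℕ} (hl : 2 ≤ l) (c : ℝ) :
    ∫ θ in (0 : ℝ)..Real.pi,
      (1 + Real.cos θ * c) * (rodrigues l l).eval (Real.cos θ) * Real.sin θ = 0 := by
  obtain ⟨k, rfl⟩ : ∃ k, l = k + 2 := ⟨l - 2, by omega⟩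
  -- Two integrations by parts of `(1 + c x) D^l`; the boundary terms involve only `D^(l-1)` and
  -- `D^(l-2)`, which vanish at `±1`.
  have h := integral_derivative_eval_cos
    ((1 + Polynomial.X * Polynomial.C c) * rodrigues (k + 2) (k + 1) -
      Polynomial.C c * rodrigues (k + 2) k)
  simp only [Polynomial.derivative_sub, Polynomial.derivative_mul, derivative_rodrigues,
    Polynomial.derivative_add, Polynomial.derivative_one, Polynomial.derivative_X,
    Polynomial.derivative_C, Polynomial.eval_sub, Polynomial.eval_add, Polynomial.eval_mul,
    Polynomial.eval_one, Polynomial.eval_X, Polynomial.eval_C, Polynomial.eval_zero,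
    eval_rodrigues_eq_zero (show k + 1 < k + 2 by omega) (one_pow 2),
    eval_rodrigues_eq_zero (show k < k + 2 by omega) (one_pow 2),
    eval_rodrigues_eq_zero (show k + 1 < k + 2 by omega) (show (-1 : ℝ) ^ 2 = 1 by norm_num),
    eval_rodrigues_eq_zero (show k < k + 2 by omega) (show (-1 : ℝ) ^ 2 = 1 by norm_num)] at h
  refine Eq.trans (intervalIntegral.integral_congr fun θ _ => ?_) (h.trans (by ring))
  ring

theorem integral_rodrigues_succ_mul_sin_sq {l : ℕ} (hl : 2 ≤ l) :
    ∫ θ in (0 : ℝ)..Real.pi,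
      Real.sin θ ^ 2 * (rodrigues l (l + 1)).eval (Real.cos θ) * Real.sin θ = 0 := by
  obtain ⟨k, rfl⟩ : ∃ k, l = k + 2 := ⟨l - 2, by omega⟩
  -- Three integrations by parts of `(1 - x²) D^(l+1)`. The term with `D^l` vanishes at `±1` through
  -- its factor `1 - x²`.
  have h := integral_derivative_eval_cos
    ((1 - Polynomial.X ^ 2) * rodrigues (k + 2) (k + 2) +
      Polynomial.C 2 * Polynomial.X * rodrigues (k + 2) (k + 1) -
      Polynomial.C 2 * rodrigues (k + 2) k)
  simp only [Polynomial.derivative_sub, Polynomial.derivative_mul, derivative_rodrigues,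
    Polynomial.derivative_add, Polynomial.derivative_one, Polynomial.derivative_X,
    Polynomial.derivative_X_pow, Polynomial.eval_pow,
    Polynomial.derivative_C, Polynomial.eval_sub, Polynomial.eval_add, Polynomial.eval_mul,
    Polynomial.eval_one, Polynomial.eval_X, Polynomial.eval_C, Polynomial.eval_zero,
    eval_rodrigues_eq_zero (show k + 1 < k + 2 by omega) (one_pow 2),
    eval_rodrigues_eq_zero (show k < k + 2 by omega) (one_pow 2),
    eval_rodrigues_eq_zero (show k + 1 < k + 2 by omega) (show (-1 : ℝ) ^ 2 = 1 by norm_num),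
    eval_rodrigues_eq_zero (show k < k + 2 by omega) (show (-1 : ℝ) ^ 2 = 1 by norm_num)] at h
  refine Eq.trans (intervalIntegral.integral_congr fun θ _ => ?_) (h.trans (by ring))
  simp only [Real.sin_sq]
  push_cast
  ring

theorem exists_conj_sphericalHarmonic (l : ℕ) (m : ℤ) : ∃ K : ℂ, ∀ θ φ : ℝ,
    (starRingEnd ℂ) (sphericalHarmonic l m (sphericalPoint θ φ)) =
      K * ((Real.sin θ ^ m.natAbs * (rodrigues l (l + m.natAbs)).eval (Real.cos θ) : ℝ) : ℂ) *
        Complex.exp (-(m * φ * Complex.I)) := by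
  obtain ⟨N, hN⟩ : ∃ N : ℝ, ∀ θ φ : ℝ, sphericalHarmonicNat l m.natAbs (sphericalPoint θ φ) =
      (N : ℂ) *
        ((Real.sin θ ^ m.natAbs * (rodrigues l (l + m.natAbs)).eval (Real.cos θ) : ℝ) : ℂ) *
        Complex.exp (m.natAbs * φ * Complex.I) := by
    refine ⟨Real.sqrt ((2 * l + 1) / (4 * Real.pi) *
      (((l - m.natAbs).factorial : ℝ) / ((l + m.natAbs).factorial : ℝ))) *
      ((-1) ^ m.natAbs / (2 ^ l * (l.factorial : ℝ))), fun θ φ => ?_⟩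
    have hexp : ((Real.sin θ * Real.cos φ : ℝ) : ℂ) +
        Complex.I * ((Real.sin θ * Real.sin φ : ℝ) : ℂ) =
        Real.sin θ * Complex.exp (φ * Complex.I) := by
      rw [Complex.exp_mul_I]; push_cast; ring
    simp only [sphericalHarmonicNat, sphericalPoint, Matrix.cons_val, hexp, legendreFactor,
      Polynomial.eval_mul, Polynomial.eval_C, rodrigues]
    rw [mul_pow, ← Complex.exp_nat_mul, mul_assoc (m.natAbs : ℂ)]
    push_cast
    ring
  by_cases hm : 0 ≤ m
  · refine ⟨N, fun θ φ => ?_⟩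
    have hcast : (m.natAbs : ℂ) = m := by
      rw [← Int.cast_natCast, Int.natAbs_of_nonneg hm]
    simp only [sphericalHarmonic, hm, if_true, hN, map_mul, Complex.conj_ofReal,
      ← Complex.exp_conj, hcast, Complex.conj_I, map_intCast, mul_neg]
  -- For negative `m` the two conjugations cancel, and `|m| = -m` gives the same exponential.
  · refine ⟨(-1) ^ m.natAbs * N, fun θ φ => ?_⟩
    have hcast : (m.natAbs : ℂ) = -m := by
      rw [← Int.cast_natCast, Int.ofNat_natAbs_of_nonpos (not_le.mp hm).le, Int.cast_neg]
    simp only [sphericalHarmonic, hm, if_false, hN, map_mul, map_pow, map_neg, map_one,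
      Complex.conj_conj, hcast, neg_mul, mul_assoc]

theorem integral_affine_mul (A₀ A₁ : ℝ → ℝ) (h₀ : Continuous A₀) (h₁ : Continuous A₁) (c : ℂ)
    (t : ℝ) :
    ∫ θ in (0 : ℝ)..Real.pi, c * ((A₀ θ + t * A₁ θ : ℝ) : ℂ) =
      c * (((∫ θ in (0 : ℝ)..Real.pi, A₀ θ) + t * ∫ θ in (0 : ℝ)..Real.pi, A₁ θ : ℝ) : ℂ) := by
  rw [intervalIntegral.integral_const_mul, intervalIntegral.integral_ofReal,
    intervalIntegral.integral_add (h₀.intervalIntegrable _ _)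
      ((h₁.const_mul t).intervalIntegrable _ _), intervalIntegral.integral_const_mul]

/-- Affine functions have no harmonics of degree at least two. -/
theorem harmonicCoeff_affine {F : UnitSphere → ℝ} {P : Space3}
    (hF : ∀ n : UnitSphere, F n = (1 + inner ℝ (n : Space3) P) / 3) {l : ℕ} (hl : 2 ≤ l) (m : ℤ) :
    harmonicCoeff F l m = 0 := by
  obtain ⟨K, hK⟩ := exists_conj_sphericalHarmonic l m
  set k := m.natAbs with hk
  set A₀ : ℝ → ℝ := fun θ => (1 + Real.cos θ * P 2) *
    (Real.sin θ ^ k * (rodrigues l (l + k)).eval (Real.cos θ)) * Real.sin θ with hA₀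
  set A₁ : ℝ → ℝ := fun θ => Real.sin θ *
    (Real.sin θ ^ k * (rodrigues l (l + k)).eval (Real.cos θ)) * Real.sin θ with hA₁
  have hin : ∀ φ : ℝ, ∫ θ in (0 : ℝ)..Real.pi, (F (sphericalPoint θ φ) : ℂ) *
      (starRingEnd ℂ) (sphericalHarmonic l m (sphericalPoint θ φ)) * (Real.sin θ : ℂ) =
      K / 3 * (Complex.exp (-(m * φ * Complex.I)) * ((∫ θ in (0 : ℝ)..Real.pi, A₀ θ : ℝ) : ℂ) +
        Complex.exp (-(m * φ * Complex.I)) * ((Real.cos φ * P 0 + Real.sin φ * P 1 : ℝ) : ℂ) *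
          ((∫ θ in (0 : ℝ)..Real.pi, A₁ θ : ℝ) : ℂ)) := by
    intro φ
    have e := integral_affine_mul A₀ A₁ (by fun_prop) (by fun_prop)
      (K / 3 * Complex.exp (-(m * φ * Complex.I))) (Real.cos φ * P 0 + Real.sin φ * P 1)
    refine (Eq.trans ?_ e).trans (by push_cast; ring)
    refine intervalIntegral.integral_congr fun θ _ => ?_
    simp only [hK, hF, hA₀, hA₁]
    have hi : inner ℝ (sphericalPoint θ φ : Space3) P =
        Real.sin θ * Real.cos φ * P 0 + Real.sin θ * Real.sin φ * P 1 + Real.cos θ * P 2 := by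
      simp [sphericalPoint, PiLp.inner_apply, Fin.sum_univ_three]
      ring
    rw [hi]
    push_cast
    ring
  -- The polar integrals matter only where the azimuthal ones may survive: `m = 0` for the part
  -- constant in `φ`, `|m| = 1` for the part in `cos φ` and `sin φ`.
  have h₀ : m = 0 → ∫ θ in (0 : ℝ)..Real.pi, A₀ θ = 0 := by
    rintro rfl
    simpa [hA₀, hk] using integral_rodrigues_mul_linear hl (P 2)
  have h₁ : k = 1 → ∫ θ in (0 : ℝ)..Real.pi, A₁ θ = 0 := by
    intro hk1
    refine Eq.trans (intervalIntegral.integral_congr fun θ _ => ?_)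
      (integral_rodrigues_succ_mul_sin_sq hl)
    simp only [hA₁, hk1]
    ring
  rw [harmonicCoeff]
  simp only [hin]
  rw [intervalIntegral.integral_const_mul,
    intervalIntegral.integral_add (Continuous.intervalIntegrable (by fun_prop) _ _)
      (Continuous.intervalIntegrable (by fun_prop) _ _),
    intervalIntegral.integral_mul_const, intervalIntegral.integral_mul_const]
  have z₀ : (∫ φ in (0 : ℝ)..2 * Real.pi, Complex.exp (-(m * φ * Complex.I))) *
      ((∫ θ in (0 : ℝ)..Real.pi, A₀ θ : ℝ) : ℂ) = 0 := by
    by_cases hm : m = 0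
    · rw [h₀ hm, Complex.ofReal_zero, mul_zero]
    · have := integral_exp_int_mul_I (neg_ne_zero.mpr hm)
      simp only [Int.cast_neg, neg_mul] at this
      rw [this, zero_mul]
  have z₁ : (∫ φ in (0 : ℝ)..2 * Real.pi, Complex.exp (-(m * φ * Complex.I)) *
      ((Real.cos φ * P 0 + Real.sin φ * P 1 : ℝ) : ℂ)) *
      ((∫ θ in (0 : ℝ)..Real.pi, A₁ θ : ℝ) : ℂ) = 0 := by
    by_cases hm : k = 1
    · rw [h₁ hm, Complex.ofReal_zero, mul_zero]
    · rw [integral_exp_mul_cos_add_sin hm, zero_mul]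
  rw [z₀, z₁, add_zero, mul_zero]

end

/-! ### The main theorem -/

theorem mainTheorem4 :
    (∀ f : trineEffects → ℝ, IsTrineFrameFunction f → Continuous (onSphere f) →
      (∃ (W : QubitOp) (P : Space3),
        W.PosSemidef ∧ W.trace = 1 ∧ (∀ E : trineEffects, (f E : ℂ) = (W * (E : QubitOp)).trace) ∧
        (∀ k, (P k : ℂ) = (W * pauli k).trace) ∧ ‖P‖ ≤ 1 ∧
        ∀ n : UnitSphere, onSphere f n = (1 + inner ℝ (n : Space3) P) / 3) ∧
      ∀ (l : ℕ) (m : ℤ), 2 ≤ l → |m| ≤ (l : ℤ) → harmonicCoeff (onSphere f) l m = 0) ∧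
    (∀ (f : trineEffects → ℝ) (P : Space3), ‖P‖ ≤ 1 →
      (∀ n : UnitSphere, onSphere f n = (1 + inner ℝ (n : Space3) P) / 3) →
      IsTrineFrameFunction f ∧ Continuous (onSphere f)) ∧
    IsTrine xzTrine ∧
    (∀ l : ℕ, ∃ κ : ℂ, κ ≠ 0 ∧
      (∀ n : UnitSphere, sphericalHarmonic l l n =
        κ * ((((n : Space3) 0 : ℝ) : ℂ) + Complex.I * (((n : Space3) 1 : ℝ) : ℂ)) ^ l) ∧
      ∑ j, sphericalHarmonic l l (xzTrine j) = κ * (1 + (-1) ^ l / 2 ^ ((l : ℤ) - 1))) ∧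
    ∀ l : ℕ, ∑ j, sphericalHarmonic l l (xzTrine j) ≠ 0 ↔ l ≠ 1 := by
  have hsum : ∀ l : ℕ, ∃ κ : ℂ, κ ≠ 0 ∧
      (∀ n : UnitSphere, sphericalHarmonic l l n =
        κ * ((((n : Space3) 0 : ℝ) : ℂ) + Complex.I * (((n : Space3) 1 : ℝ) : ℂ)) ^ l) ∧
      ∑ j, sphericalHarmonic l l (xzTrine j) = κ * (1 + (-1) ^ l / 2 ^ ((l : ℤ) - 1)) := by
    intro l
    obtain ⟨κ, hκ, h⟩ := exists_sphericalHarmonic_self l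
    refine ⟨κ, hκ, h, ?_⟩
    rw [← sum_xzTrine_pow]
    exact Finset.sum_congr rfl fun j _ => h _
  refine ⟨fun f hf hc => ?_, fun f P hP h => isTrineFrameFunction_of_eq hP h, isTrine_xzTrine,
    hsum, fun l => ?_⟩
  · obtain ⟨P, hP, h⟩ := hf.exists_eq_inner hc
    refine ⟨⟨(1 / 2 : ℂ) • (1 + ∑ k, ((P k : ℝ) : ℂ) • pauli k), P, posSemidef_blochOp hP,
      trace_blochOp P, ?_, fun k => (trace_blochOp_mul_pauli P k).symm, hP, h⟩,
      fun l m hl _ => harmonicCoeff_affine h hl m⟩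
    rintro ⟨_, n, rfl⟩
    rw [effectOp_trace_mul, ← h n]
    rfl
  · obtain ⟨κ, hκ, -, h⟩ := hsum l
    rw [h, mul_ne_zero_iff, one_add_neg_one_pow_div_ne_zero_iff]
    exact and_iff_right hκ
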